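/- For a finite set $H\subset\mathbb{R}^n$ and $x\in\mathbb{R}^n$ let $\mathcal{A}_H(x)=(\mathrm{sign}\langle h,x\rangle : h\in H)\in\{-,0,+\}^H$. A set $S\subset\mathbb{R}^n$ \emph{infers} $h\in\mathbb{R}^n$ at $x$ if $\mathrm{sign}\langle h,x'\rangle=\mathrm{sign}\langle h,x\rangle$ for every $x'\in\mathbb{R}^n$ with $\mathcal{A}_{S\cup(S-S)}(x')=\mathcal{A}_{S\cup(S-S)}(x)$, where $S-S=\{h'-h'':h',h''\in S\}$. The \emph{inference dimension} of $H$ is the minimal $d\ge 1$ such that for every $S\subseteq H$ with $|S|\ge d$ and every $x\in\mathbb{R}^n$ there is $h\in S$ such that $S\setminus\{h\}$ infers $h$ at $x$. A \emph{comparison decision tree} for $H$ is a (deterministic) ternary decision tree in which every inner node queries $\mathrm{sign}\langle h,x\rangle$ for some $h\in H$ or $\mathrm{sign}\langle h'-h'',x\rangle$ for some $h',h''\in H$ and branches on the answer in $\{-,0,+\}$. Its \emph{query complexity} is the maximum over $x\in\mathbb{R}^n$ of the number of queries performed on input $x$. \textbf{Theorem.} There is an absolute constant $C>0$ such that the following holds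 for every $n$. Let $H\subset\mathbb{R}^n$ be a finite set with $|H|\ge 2$ and with inference dimension $d$. Then there exists a comparison decision tree for $H$ which computes $\mathcal{A}_H(x)$ correctly on every input $x\in\mathbb{R}^n$ and whose query complexity is at most $$C\,\bigl(d+n\log(nd)\bigr)\log|H|.$$ -/

import Mathlib

namespace PointLocation

open scoped Pointwise

/-- The sign pattern `𝒜_H(x) = (sign ⟨h, x⟩ : h ∈ H) ∈ {-, 0, +}^H`. -/
noncomputable def signVector {n : ℕ} (H : Set (EuclideanSpace ℝ (Fin n)))
    (x : EuclideanSpace ℝ (Fin n)) : H → SignType :=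
  fun h => SignType.sign (inner ℝ (h : EuclideanSpace ℝ (Fin n)) x)

/-- The vectors `S ∪ (S - S)` of the label queries `h ∈ S` and of the comparison queries
`h' - h''`, `h', h'' ∈ S`. -/
def queryVectors {n : ℕ} (S : Set (EuclideanSpace ℝ (Fin n))) :
    Set (EuclideanSpace ℝ (Fin n)) :=
  S ∪ (S - S)

/-- `S` infers `h` at `x`: the sign of `⟨h, x⟩` is determined by the answers at `x` to the label
and comparison queries on `S`. -/
def Infers {n : ℕ} (S : Set (EuclideanSpace ℝ (Fin n))) (h x : EuclideanSpace ℝ (Fin n)) : Prop :=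
  ∀ x' : EuclideanSpace ℝ (Fin n),
    signVector (queryVectors S) x' = signVector (queryVectors S) x →
      (SignType.sign (inner ℝ h x') : SignType) = SignType.sign (inner ℝ h x)

/-- `d` is the inference dimension of `H`: the minimal `d ≥ 1` such that for every `S ⊆ H` with
`|S| ≥ d` and every `x` there is `h ∈ S` such that `S \ {h}` infers `h` at `x`. -/
def IsInferenceDimension {n : ℕ} (H : Set (EuclideanSpace ℝ (Fin n))) (d : ℕ) : Prop :=
  IsLeast {k : ℕ | 1 ≤ k ∧ ∀ S ⊆ H, (k : ℕ∞) ≤ S.encard →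
    ∀ x : EuclideanSpace ℝ (Fin n), ∃ h ∈ S, Infers (S \ {h}) h x} d

/-- Ternary linear decision trees on inputs in `ℝⁿ` with outputs in `α`: an inner node asks for the
sign of `⟨q, x⟩` and branches on the answer. -/
inductive LinearDecisionTree (n : ℕ) (α : Type*) where
  | leaf (output : α) : LinearDecisionTree n α
  | node (q : EuclideanSpace ℝ (Fin n)) (child : SignType → LinearDecisionTree n α) :
      LinearDecisionTree n α

namespace LinearDecisionTree

/-- The output of the tree on input `x`. -/
noncomputable def eval {n : ℕ} {α : Type*} :
    LinearDecisionTree n α → EuclideanSpace ℝ (Fin n) → α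
  | leaf output, _ => output
  | node q child, x => (child (SignType.sign (inner ℝ q x))).eval x

/-- The number of queries performed by the tree on input `x`. -/
noncomputable def numQueries {n : ℕ} {α : Type*} :
    LinearDecisionTree n α → EuclideanSpace ℝ (Fin n) → ℕ
  | leaf _, _ => 0
  | node q child, x => (child (SignType.sign (inner ℝ q x))).numQueries x + 1

/-- A comparison decision tree for `H`: all its queries are label queries `sign ⟨h, x⟩`, `h ∈ H`,
or comparison queries `sign ⟨h' - h'', x⟩`, `h', h'' ∈ H`. -/
def IsComparisonTree {n : ℕ} {α : Type*} (H : Set (EuclideanSpace ℝ (Fin n))) :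
    LinearDecisionTree n α → Prop
  | leaf _ => True
  | node q child => q ∈ queryVectors H ∧ ∀ s, (child s).IsComparisonTree H

end LinearDecisionTree

end PointLocation

namespace PointLocation

open scoped Pointwise
open Module

variable {n : ℕ}

/-! The tree works in rounds. A set `S` of `2k` remaining vectors, with `k` of order `d + n
log(nd)`, is chosen independently of the input so that at every `x` it infers at least a quarter of
the remaining vectors (`exists_inferring_subset`). All label and comparison queries on `S` are
answered by sorting the forms of `S ∪ {0}`, which takes O(k) queries, and the inferred vectors are
discarded. After O(log |H|) rounds at most `8k` vectors remain, and their labels are queried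
directly.

Sorting is cheap because only about `|S|^(2n)` answer patterns occur in dimension `n`
(`encard_queryPattern_le`): a binary search that halves the number of surviving patterns inserts all
forms with O(|S| + n log |S|) comparisons (`Solvable.sorting`).

The set `S` exists by double counting pairs `S ⊆ Q`, `|Q| = 4k`, such that at some point `S` infers
nothing in `Q \ S`. If every `S` were bad, each would lie in many such `Q`. But a fixed `Q` admits
few such `S`: up to the choice of an answer pattern on `Q`, they form a family of closed sets that
shatters no set of size `d`, so Sauer-Shelah applies (`card_closed_le`). -/

/-! ### Counting the sign patterns of a central arrangement -/

/-- The signs of `⟨h, x⟩` for `h ∈ s`, extended by `0` outside `s`. -/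
noncomputable def signPattern (s : Set (EuclideanSpace ℝ (Fin n))) (x : EuclideanSpace ℝ (Fin n)) :
    EuclideanSpace ℝ (Fin n) → SignType :=
  s.indicator fun h => SignType.sign (inner ℝ h x)

theorem signPattern_eq_iff {s : Set (EuclideanSpace ℝ (Fin n))} {x y : EuclideanSpace ℝ (Fin n)} :
    signPattern s x = signPattern s y ↔
      ∀ h ∈ s, (SignType.sign (inner ℝ h x) : SignType) = SignType.sign (inner ℝ h y) := by
  constructor
  · intro e h hh
    have := congrFun e h
    simpa [signPattern, hh] using this
  · intro e
    funext h
    by_cases hh : h ∈ s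
    · simpa [signPattern, hh] using e h hh
    · simp [signPattern, hh]

theorem signVector_eq_iff {s : Set (EuclideanSpace ℝ (Fin n))} {x y : EuclideanSpace ℝ (Fin n)} :
    signVector s x = signVector s y ↔
      ∀ h ∈ s, (SignType.sign (inner ℝ h x) : SignType) = SignType.sign (inner ℝ h y) := by
  constructor
  · intro e h hh
    exact congrFun e ⟨h, hh⟩
  · intro e
    funext h
    exact e h h.2

theorem sign_add_eq_of_sign_eq {a b c e : ℝ} (ha : 0 < a) (hb : 0 < b)
    (h : SignType.sign c = SignType.sign e) :
    SignType.sign (a * c + b * e) = SignType.sign c := by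
  rcases lt_trichotomy c 0 with hc | hc | hc
  · have he : e < 0 := by rwa [sign_neg hc, eq_comm, sign_eq_neg_one_iff] at h
    rw [sign_neg hc, sign_neg]
    nlinarith [mul_pos ha (neg_pos.2 hc), mul_pos hb (neg_pos.2 he)]
  · have he : e = 0 := by rwa [hc, sign_zero, eq_comm, sign_eq_zero_iff] at h
    simp [hc, he]
  · have he : 0 < e := by rwa [sign_pos hc, eq_comm, sign_eq_one_iff] at h
    rw [sign_pos hc, sign_pos]
    positivity

theorem signPattern_insert_image_subset (a : EuclideanSpace ℝ (Fin n))
    (s A : Set (EuclideanSpace ℝ (Fin n))) :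
    signPattern (insert a s) '' A ⊆
      ⋃ σ : SignType, (fun p => Function.update p a σ) ''
        (signPattern s '' {x ∈ A | SignType.sign (inner ℝ a x) = σ}) := by
  rintro _ ⟨x, hx, rfl⟩
  refine Set.mem_iUnion.2 ⟨SignType.sign (inner ℝ a x), signPattern s x, ⟨x, ⟨hx, rfl⟩, rfl⟩, ?_⟩
  funext h
  by_cases hh : h = a
  · subst hh
    simp [signPattern]
  · by_cases hs : h ∈ s <;> simp [signPattern, hh, hs]

theorem encard_signPattern_insert_le (a : EuclideanSpace ℝ (Fin n))
    (s A : Set (EuclideanSpace ℝ (Fin n))) :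
    (signPattern (insert a s) '' A).encard ≤
      (signPattern s '' {x ∈ A | inner ℝ a x = 0}).encard +
      ((signPattern s '' {x ∈ A | 0 < inner ℝ a x}).encard +
       (signPattern s '' {x ∈ A | inner ℝ a x < 0}).encard) := by
  refine (Set.encard_le_encard (signPattern_insert_image_subset a s A)).trans ?_
  have : (⋃ σ : SignType, (fun p => Function.update p a σ) ''
        (signPattern s '' {x ∈ A | SignType.sign (inner ℝ a x) = σ})) ⊆
      ((fun p => Function.update p a 0) '' (signPattern s '' {x ∈ A | inner ℝ a x = 0})) ∪
      (((fun p => Function.update p a 1) '' (signPattern s '' {x ∈ A | 0 < inner ℝ a x})) ∪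
       ((fun p => Function.update p a (-1)) '' (signPattern s '' {x ∈ A | inner ℝ a x < 0}))) := by
    refine Set.iUnion_subset fun σ => ?_
    rcases σ with _ | _ | _
    · refine Set.subset_union_of_subset_left ?_ _
      simp only [SignType.zero_eq_zero, sign_eq_zero_iff]
      exact subset_rfl
    · refine Set.subset_union_of_subset_right (Set.subset_union_of_subset_right ?_ _) _
      simp only [SignType.neg_eq_neg_one, sign_eq_neg_one_iff]
      exact subset_rfl
    · refine Set.subset_union_of_subset_right (Set.subset_union_of_subset_left ?_ _) _
      simp only [SignType.pos_eq_one, sign_eq_one_iff]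
      exact subset_rfl
  refine (Set.encard_le_encard this).trans ((Set.encard_union_le _ _).trans ?_)
  refine add_le_add (Set.encard_image_le _ _) ((Set.encard_union_le _ _).trans ?_)
  exact add_le_add (Set.encard_image_le _ _) (Set.encard_image_le _ _)

/-- Two points with the same pattern on opposite sides of `a = 0` have a positive combination on
that hyperplane, and positive combinations keep a common pattern. -/
theorem signPattern_pos_inter_neg_subset (a : EuclideanSpace ℝ (Fin n))
    (s : Set (EuclideanSpace ℝ (Fin n))) (V : Submodule ℝ (EuclideanSpace ℝ (Fin n))) :
    (signPattern s '' {x ∈ (V : Set _) | 0 < inner ℝ a x}) ∩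
      (signPattern s '' {x ∈ (V : Set _) | inner ℝ a x < 0}) ⊆
      signPattern s '' {x ∈ (V : Set _) | inner ℝ a x = 0} := by
  rintro _ ⟨⟨x, ⟨hxV, hx⟩, rfl⟩, y, ⟨hyV, hy⟩, hxy⟩
  refine ⟨(-inner ℝ a y) • x + (inner ℝ a x) • y,
    ⟨V.add_mem (V.smul_mem _ hxV) (V.smul_mem _ hyV), ?_⟩, ?_⟩
  · rw [inner_add_right, inner_smul_right, inner_smul_right]
    ring
  · rw [signPattern_eq_iff] at hxy ⊢
    intro h hh
    rw [inner_add_right, inner_smul_right, inner_smul_right]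
    exact sign_add_eq_of_sign_eq (neg_pos.2 hy) hx (hxy h hh).symm

/-- The number of cells of a central arrangement of hyperplanes in a subspace. -/
theorem encard_signPattern_image_le (s : Finset (EuclideanSpace ℝ (Fin n))) :
    ∀ V : Submodule ℝ (EuclideanSpace ℝ (Fin n)),
      (signPattern (s : Set (EuclideanSpace ℝ (Fin n))) '' (V : Set _)).encard ≤
        (((2 * s.card + 1) ^ finrank ℝ V : ℕ) : ℕ∞) := by
  classical
  induction s using Finset.induction_on with
  | empty =>
    intro V
    have : signPattern ((∅ : Finset (EuclideanSpace ℝ (Fin n))) : Set (EuclideanSpace ℝ (Fin n))) ''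
        (V : Set _) ⊆ {0} := by
      rintro _ ⟨x, -, rfl⟩
      simp only [signPattern, Finset.coe_empty, Set.indicator_empty, Set.mem_singleton_iff]
      rfl
    simpa using Set.encard_le_encard this
  | insert a s ha ih =>
    intro V
    rw [Finset.coe_insert, Finset.card_insert_of_notMem ha]
    refine (encard_signPattern_insert_le a _ _).trans ?_
    by_cases hV : ∀ x ∈ V, inner ℝ a x = 0
    · have h1 : {x ∈ (V : Set (EuclideanSpace ℝ (Fin n))) | 0 < inner ℝ a x} = ∅ := by
        ext x
        simp only [Set.mem_ofPred_eq, Set.mem_empty_iff_false, iff_false, not_and, not_lt]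
        exact fun hx => (hV x hx).le
      have h2 : {x ∈ (V : Set (EuclideanSpace ℝ (Fin n))) | inner ℝ a x < 0} = ∅ := by
        ext x
        simp only [Set.mem_ofPred_eq, Set.mem_empty_iff_false, iff_false, not_and, not_lt]
        exact fun hx => (hV x hx).ge
      rw [h1, h2]
      simp only [Set.image_empty, Set.encard_empty, add_zero]
      refine (Set.encard_le_encard (Set.image_mono (Set.sep_subset _ _))).trans ((ih V).trans ?_)
      exact_mod_cast Nat.pow_le_pow_left (by omega) _
    · push Not at hV
      obtain ⟨v, hv, hav⟩ := hV
      set W : Submodule ℝ (EuclideanSpace ℝ (Fin n)) := V ⊓ LinearMap.ker (innerₛₗ ℝ a) with hW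
      have hWset : {x ∈ (V : Set (EuclideanSpace ℝ (Fin n))) | inner ℝ a x = 0} = (W : Set _) := by
        ext x
        simp [hW]
      have hlt : finrank ℝ W < finrank ℝ V := by
        refine Submodule.finrank_lt_finrank_of_lt (lt_of_le_of_ne inf_le_left fun e => hav ?_)
        have : v ∈ W := by rw [e]; exact hv
        simpa [hW, hv] using this
      have hint := Set.encard_le_encard
        (signPattern_pos_inter_neg_subset a (s : Set (EuclideanSpace ℝ (Fin n))) V)
      have hun := Set.encard_union_add_encard_inter
        (signPattern (s : Set _) '' {x ∈ (V : Set (EuclideanSpace ℝ (Fin n))) | 0 < inner ℝ a x})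
        (signPattern (s : Set _) '' {x ∈ (V : Set (EuclideanSpace ℝ (Fin n))) | inner ℝ a x < 0})
      have hsub : (signPattern (s : Set _) ''
            {x ∈ (V : Set (EuclideanSpace ℝ (Fin n))) | 0 < inner ℝ a x}) ∪
          (signPattern (s : Set _) ''
            {x ∈ (V : Set (EuclideanSpace ℝ (Fin n))) | inner ℝ a x < 0}) ⊆
          signPattern (s : Set _) '' (V : Set _) :=
        Set.union_subset (Set.image_mono (Set.sep_subset _ _))
          (Set.image_mono (Set.sep_subset _ _))
      -- Positive plus negative count equals union plus intersection. Writing `N` for the number of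
      -- patterns, this gives N(s ∪ {a}, V) ≤ N(s, V) + 2 N(s, W) with `W` of smaller dimension.
      rw [← hun]
      rw [hWset] at hint ⊢
      refine (add_le_add (ih W) (add_le_add ((Set.encard_le_encard hsub).trans (ih V))
        (hint.trans (ih W)))).trans ?_
      norm_cast
      obtain ⟨r, hr⟩ : ∃ r, finrank ℝ V = r + 1 := ⟨finrank ℝ V - 1, by omega⟩
      have hWr : (2 * s.card + 1) ^ finrank ℝ W ≤ (2 * s.card + 1) ^ r :=
        Nat.pow_le_pow_right (by omega) (by omega)
      have hmono : (2 * s.card + 1) ^ r ≤ (2 * (s.card + 1) + 1) ^ r :=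
        Nat.pow_le_pow_left (by omega) _
      rw [hr, pow_succ, pow_succ]
      nlinarith [Nat.mul_le_mul_right (2 * s.card + 3) hmono]

theorem encard_queryVectors_le (Q : Finset (EuclideanSpace ℝ (Fin n))) :
    (queryVectors (Q : Set (EuclideanSpace ℝ (Fin n)))).encard ≤
      ((Q.card + Q.card ^ 2 : ℕ) : ℕ∞) := by
  classical
  have : queryVectors (Q : Set (EuclideanSpace ℝ (Fin n))) =
      ((Q ∪ (Q - Q) : Finset (EuclideanSpace ℝ (Fin n))) : Set (EuclideanSpace ℝ (Fin n))) := by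
    simp [queryVectors]
  rw [this, Set.encard_coe_eq_coe_finsetCard]
  norm_cast
  refine (Finset.card_union_le _ _).trans ?_
  have := Finset.card_sub_le (s := Q) (t := Q)
  nlinarith

/-- The number of answer patterns to the label and comparison queries on `Q`. -/
theorem encard_queryPattern_le (Q : Finset (EuclideanSpace ℝ (Fin n))) :
    (Set.range (signPattern (queryVectors (Q : Set (EuclideanSpace ℝ (Fin n)))))).encard ≤
      (((2 * (Q.card + Q.card ^ 2) + 1) ^ n : ℕ) : ℕ∞) := by
  classical
  have hfin : (queryVectors (Q : Set (EuclideanSpace ℝ (Fin n)))).Finite :=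
    Set.finite_of_encard_le_coe (encard_queryVectors_le Q)
  have hcard : hfin.toFinset.card ≤ Q.card + Q.card ^ 2 := by
    have := encard_queryVectors_le Q
    rw [hfin.encard_eq_coe_toFinset_card] at this
    exact_mod_cast this
  have := encard_signPattern_image_le hfin.toFinset ⊤
  rw [finrank_top, finrank_euclideanSpace_fin, hfin.coe_toFinset, Submodule.top_coe,
    Set.image_univ] at this
  refine this.trans ?_
  exact_mod_cast Nat.pow_le_pow_left (by omega) _

/-! ### Decision trees restricted to a set of inputs -/

/-- Some comparison tree for `H` computes `g` on all inputs from `A` with at most `k` queries. -/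
def Solvable {α : Type*} (H : Set (EuclideanSpace ℝ (Fin n))) (g : EuclideanSpace ℝ (Fin n) → α)
    (A : Set (EuclideanSpace ℝ (Fin n))) (k : ℕ) : Prop :=
  ∃ T : LinearDecisionTree n α, T.IsComparisonTree H ∧ ∀ x ∈ A, T.eval x = g x ∧ T.numQueries x ≤ k

namespace Solvable

variable {α : Type*} {H : Set (EuclideanSpace ℝ (Fin n))} {g : EuclideanSpace ℝ (Fin n) → α}
  {A B : Set (EuclideanSpace ℝ (Fin n))} {k l : ℕ}

theorem mono (h : Solvable H g A k) (hkl : k ≤ l) : Solvable H g A l := by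
  obtain ⟨T, hT, h⟩ := h
  exact ⟨T, hT, fun x hx => ⟨(h x hx).1, (h x hx).2.trans hkl⟩⟩

theorem of_const (h : ∀ x ∈ A, ∀ y ∈ A, g x = g y) : Solvable H g A 0 := by
  rcases A.eq_empty_or_nonempty with rfl | ⟨y, hy⟩
  · exact ⟨.leaf (g 0), trivial, fun x hx => hx.elim⟩
  · exact ⟨.leaf (g y), trivial, fun x hx => ⟨h y hy x hx, le_rfl⟩⟩

theorem of_not_nonempty (h : ¬ A.Nonempty) : Solvable H g A k :=
  (of_const fun x hx => (h ⟨x, hx⟩).elim).mono (Nat.zero_le k)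

theorem query {q : EuclideanSpace ℝ (Fin n)} (hq : q ∈ queryVectors H)
    (h : ∀ s, Solvable H g {x ∈ A | SignType.sign (inner ℝ q x) = s} k) :
    Solvable H g A (k + 1) := by
  choose T hT h using h
  refine ⟨.node q T, ⟨hq, hT⟩, fun x hx => ?_⟩
  obtain ⟨h1, h2⟩ := h _ x ⟨hx, rfl⟩
  exact ⟨h1, Nat.succ_le_succ h2⟩

/-- Branching on the order of `⟨a, x⟩` and `⟨b, x⟩`. -/
theorem compare {a b : EuclideanSpace ℝ (Fin n)} (hH : H.Nonempty) (ha : a ∈ insert 0 H)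
    (hb : b ∈ insert 0 H)
    (hlt : Solvable H g {x ∈ A | inner ℝ a x < inner ℝ b x} k)
    (heq : Solvable H g {x ∈ A | inner ℝ a x = inner ℝ b x} k)
    (hgt : Solvable H g {x ∈ A | inner ℝ b x < inner ℝ a x} k) :
    Solvable H g A (k + 1) := by
  -- Admitting 0 as a form makes label queries a case of comparisons; 0 against itself is realised
  -- as `c - c`.
  have key : a - b ∈ queryVectors H ∨ b - a ∈ queryVectors H := by
    rcases ha with rfl | ha <;> rcases hb with rfl | hb
    · obtain ⟨c, hc⟩ := hH
      refine Or.inl (Or.inr ?_)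
      rw [sub_zero, ← sub_self c]
      exact Set.sub_mem_sub hc hc
    · exact Or.inr (Or.inl (by simpa using hb))
    · exact Or.inl (Or.inl (by simpa using ha))
    · exact Or.inl (Or.inr (Set.sub_mem_sub ha hb))
  rcases key with hq | hq
  · refine query hq fun s => ?_
    rcases s with _ | _ | _
    · simpa [sign_eq_zero_iff, inner_sub_left, sub_eq_zero] using heq
    · simpa [sign_eq_neg_one_iff, inner_sub_left] using hlt
    · simpa [sign_eq_one_iff, inner_sub_left] using hgt
  · refine query hq fun s => ?_
    rcases s with _ | _ | _
    · have heq' : Solvable H g {x ∈ A | inner ℝ b x = inner ℝ a x} k := by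
        simpa only [eq_comm] using heq
      simpa [sign_eq_zero_iff, inner_sub_left, sub_eq_zero] using heq'
    · simpa [sign_eq_neg_one_iff, inner_sub_left] using hgt
    · simpa [sign_eq_one_iff, inner_sub_left] using hlt

/-- Querying all labels of a finite set `R`. -/
theorem of_labels (R : Finset (EuclideanSpace ℝ (Fin n))) (hR : (R : Set _) ⊆ H) :
    ∀ A : Set (EuclideanSpace ℝ (Fin n)),
      (∀ B ⊆ A, (∀ h ∈ R, ∀ x ∈ B, ∀ y ∈ B,
        (SignType.sign (inner ℝ h x) : SignType) = SignType.sign (inner ℝ h y)) →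
        Solvable H g B k) → Solvable H g A (k + R.card) := by
  classical
  induction R using Finset.induction_on with
  | empty => exact fun A hA => hA A subset_rfl (by simp)
  | insert a R ha ih =>
    intro A hA
    rw [Finset.card_insert_of_notMem ha, ← add_assoc]
    rw [Finset.coe_insert, Set.insert_subset_iff] at hR
    refine query (Or.inl hR.1) fun s => ih hR.2 _ fun B hB hsign => ?_
    refine hA B (hB.trans (Set.sep_subset _ _)) fun h hh x hx y hy => ?_
    rcases Finset.mem_insert.1 hh with rfl | hh
    · exact (hB hx).2.trans (hB hy).2.symm
    · exact hsign h hh x hx y hy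

end Solvable

/-! ### Sorting linear forms by pattern-halving insertion -/

/-- The linear forms from `T` are ordered in the same way at all points of `A`. -/
def OrderConst (T A : Set (EuclideanSpace ℝ (Fin n))) : Prop :=
  ∀ x ∈ A, ∀ y ∈ A, ∀ a ∈ T, ∀ b ∈ T, inner ℝ a x < inner ℝ b x → inner ℝ a y < inner ℝ b y

namespace OrderConst

variable {T A B : Set (EuclideanSpace ℝ (Fin n))}

theorem mono (h : OrderConst T A) (hB : B ⊆ A) : OrderConst T B :=
  fun x hx y hy => h x (hB hx) y (hB hy)

theorem le (h : OrderConst T A) {x y a b : EuclideanSpace ℝ (Fin n)} (hx : x ∈ A) (hy : y ∈ A)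
    (ha : a ∈ T) (hb : b ∈ T) (hab : inner ℝ a x ≤ inner ℝ b x) :
    (inner ℝ a y : ℝ) ≤ inner ℝ b y := by
  by_contra hlt
  exact absurd (h y hy x hx b hb a ha (not_le.1 hlt)) (not_lt.2 hab)

theorem insert_of_eq (h : OrderConst T A) {a c : EuclideanSpace ℝ (Fin n)} (ha : a ∈ T)
    (hc : ∀ x ∈ A, inner ℝ c x = inner ℝ a x) : OrderConst (insert c T) A := by
  rintro x hx y hy e (rfl | he) f (rfl | hf)
  · simp
  · rw [hc x hx, hc y hy]
    exact h x hx y hy a ha f hf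
  · rw [hc x hx, hc y hy]
    exact h x hx y hy e he a ha
  · exact h x hx y hy e he f hf

theorem insert_of_lt_or_gt (h : OrderConst T A) {c : EuclideanSpace ℝ (Fin n)}
    (hc : ∀ e ∈ T, (∀ x ∈ A, inner ℝ e x < inner ℝ c x) ∨ ∀ x ∈ A, inner ℝ c x < inner ℝ e x) :
    OrderConst (insert c T) A := by
  rintro x hx y hy e (rfl | he) f (rfl | hf) hlt
  · exact absurd hlt (lt_irrefl _)
  · rcases hc f hf with h1 | h1
    · exact absurd hlt (h1 x hx).not_gt
    · exact h1 y hy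
  · rcases hc e he with h1 | h1
    · exact h1 y hy
    · exact absurd hlt (h1 x hx).not_gt
  · exact h x hx y hy e he f hf hlt

theorem signVector_eq {S : Set (EuclideanSpace ℝ (Fin n))} (h : OrderConst (insert 0 S) A)
    {x y : EuclideanSpace ℝ (Fin n)} (hx : x ∈ A) (hy : y ∈ A) :
    signVector (queryVectors S) x = signVector (queryVectors S) y := by
  have key : ∀ a ∈ insert 0 S, ∀ b ∈ insert 0 S,
      (SignType.sign (inner ℝ (a - b) x : ℝ)) = SignType.sign (inner ℝ (a - b) y : ℝ) := by
    intro a ha b hb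
    rw [inner_sub_left, inner_sub_left]
    rcases lt_trichotomy (inner ℝ a x : ℝ) (inner ℝ b x) with hl | hl | hl
    · rw [sign_neg (sub_neg.2 hl), sign_neg (sub_neg.2 (h x hx y hy a ha b hb hl))]
    · have := le_antisymm (h.le hx hy ha hb hl.le) (h.le hx hy hb ha hl.ge)
      rw [hl, this, sub_self, sub_self]
    · rw [sign_pos (sub_pos.2 hl), sign_pos (sub_pos.2 (h x hx y hy b hb a ha hl))]
  rw [signVector_eq_iff]
  rintro q (hq | ⟨a, ha, b, hb, rfl⟩)
  · simpa using key q (Or.inr hq) 0 (Or.inl rfl)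
  · exact key a (Or.inr ha) b (Or.inr hb)

end OrderConst

theorem inner_lt_of_signPattern_eq {S : Set (EuclideanSpace ℝ (Fin n))}
    {x y a b : EuclideanSpace ℝ (Fin n)}
    (h : signPattern (queryVectors S) x = signPattern (queryVectors S) y)
    (ha : a ∈ insert 0 S) (hb : b ∈ insert 0 S) (hab : inner ℝ a x < inner ℝ b x) :
    (inner ℝ a y : ℝ) < inner ℝ b y := by
  rw [signPattern_eq_iff] at h
  rcases ha with rfl | ha <;> rcases hb with rfl | hb
  · exact absurd hab (lt_irrefl _)
  · have := h b (Or.inl hb)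
    rw [inner_zero_left] at hab ⊢
    rwa [sign_pos hab, eq_comm, sign_eq_one_iff] at this
  · have := h a (Or.inl ha)
    rw [inner_zero_left] at hab ⊢
    rwa [sign_neg hab, eq_comm, sign_eq_neg_one_iff] at this
  · have := h (a - b) (Or.inr (Set.sub_mem_sub ha hb))
    rw [inner_sub_left, inner_sub_left] at this
    rw [sign_neg (sub_neg.2 hab), eq_comm, sign_eq_neg_one_iff] at this
    exact sub_neg.1 this

theorem natLog_two_add_one_le {a b : ℕ} (ha : a ≠ 0) (h : 2 * a ≤ b) :
    Nat.log 2 a + 1 ≤ Nat.log 2 b := by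
  refine Nat.le_log_of_pow_le one_lt_two ?_
  have := Nat.pow_log_le_self 2 ha
  rw [pow_succ]
  omega

section Sorting

variable {α β : Type*} {H : Set (EuclideanSpace ℝ (Fin n))} {g : EuclideanSpace ℝ (Fin n) → α}
  {S : Set (EuclideanSpace ℝ (Fin n))} {p : EuclideanSpace ℝ (Fin n) → β}

/-- Inserting a form into a sorted list by a binary search that halves the number of remaining
patterns. -/
theorem Solvable.insertion (hH : H.Nonempty) (hS : S ⊆ insert 0 H) (hfin : (Set.range p).Finite)
    (hp : ∀ x y, p x = p y → ∀ a ∈ S, ∀ b ∈ S, inner ℝ a x < inner ℝ b x →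
      inner ℝ a y < inner ℝ b y)
    {T : Finset (EuclideanSpace ℝ (Fin n))} (hT : (T : Set _) ⊆ S)
    {c : EuclideanSpace ℝ (Fin n)} (hc : c ∈ S) {k : ℕ} :
    ∀ A : Set (EuclideanSpace ℝ (Fin n)), A.Nonempty → OrderConst (T : Set _) A →
      (∀ B ⊆ A, B.Nonempty → OrderConst (insert c (T : Set _)) B →
        Solvable H g B (k + 2 * Nat.log 2 (p '' B).ncard)) →
      Solvable H g A (k + 2 + 2 * Nat.log 2 (p '' A).ncard) := by
  classical
  intro A
  induction hN : (p '' A).ncard using Nat.strong_induction_on generalizing A with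
  | _ N ih =>
  subst hN
  intro hA hTA hB
  obtain ⟨x₀, hx₀⟩ := hA
  have himfin : ∀ B : Set (EuclideanSpace ℝ (Fin n)), (p '' B).Finite :=
    fun B => hfin.subset (Set.image_subset_range p B)
  have hlogmono : ∀ B ⊆ A, Nat.log 2 (p '' B).ncard ≤ Nat.log 2 (p '' A).ncard := fun B hBA =>
    Nat.log_mono_right (Set.ncard_le_ncard (Set.image_mono hBA) (himfin A))
  have hfinal : ∀ B ⊆ A, OrderConst (insert c (T : Set _)) B →
      Solvable H g B (k + 2 * Nat.log 2 (p '' A).ncard) := by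
    intro B hBA hBo
    by_cases hne : B.Nonempty
    · exact (hB B hBA hne hBo).mono (by have := hlogmono B hBA; omega)
    · exact of_not_nonempty hne
  have hhalf : ∀ B ⊆ A, 2 * (p '' B).ncard ≤ (p '' A).ncard →
      Solvable H g B (k + 2 * Nat.log 2 (p '' A).ncard) := by
    intro B hBA hcard
    by_cases hne : B.Nonempty
    · have hpos : 0 < (p '' B).ncard := (Set.ncard_pos (himfin B)).2 (hne.image p)
      have := natLog_two_add_one_le hpos.ne' hcard
      exact (ih _ (by omega) B rfl hne (hTA.mono hBA)
        fun C hC => hB C (hC.trans hBA)).mono (by omega)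
    · exact of_not_nonempty hne
  -- Weighted median: `lo` holds the forms `e` for which the answer `c < e` leaves at most half of
  -- the patterns. For the other forms the answer `e < c` does, since `p` determines the order and
  -- so the two answers have disjoint patterns.
  set lo := T.filter fun e =>
    2 * (p '' {x ∈ A | inner ℝ c x < inner ℝ e x}).ncard ≤ (p '' A).ncard with hlo
  have hmemlo : ∀ e, e ∈ lo ↔ e ∈ T ∧
      2 * (p '' {x ∈ A | inner ℝ c x < inner ℝ e x}).ncard ≤ (p '' A).ncard :=
    fun e => Finset.mem_filter
  have hhi : ∀ e ∈ T, e ∉ lo →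
      2 * (p '' {x ∈ A | inner ℝ e x < inner ℝ c x}).ncard ≤ (p '' A).ncard := by
    intro e he hel
    have h1 : (p '' A).ncard < 2 * (p '' {x ∈ A | inner ℝ c x < inner ℝ e x}).ncard := by
      by_contra hcon
      exact hel ((hmemlo e).2 ⟨he, not_lt.1 hcon⟩)
    have hdisj : Disjoint (p '' {x ∈ A | inner ℝ c x < inner ℝ e x})
        (p '' {x ∈ A | inner ℝ e x < inner ℝ c x}) := by
      rw [Set.disjoint_left]
      rintro _ ⟨x, hx, rfl⟩ ⟨y, hy, hyx⟩
      exact absurd (hp y x hyx e (hT he) c hc hy.2) hx.2.not_gt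
    have h2 := Set.ncard_union_eq hdisj (himfin _) (himfin _)
    have h3 := Set.ncard_le_ncard (Set.union_subset
      (Set.image_mono (f := p) (Set.sep_subset A fun x => inner ℝ c x < inner ℝ e x))
      (Set.image_mono (f := p) (Set.sep_subset A fun x => inner ℝ e x < inner ℝ c x))) (himfin A)
    omega
  -- Once `c` is above all of `lo`, comparing it with the least form `b` outside `lo` either fixes
  -- its position or halves the patterns. With the earlier comparison against the largest form of
  -- `lo`, this makes two queries per halving.
  have stage : ∀ B ⊆ A, (∀ e ∈ lo, ∀ x ∈ B, inner ℝ e x < inner ℝ c x) →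
      Solvable H g B (k + 2 * Nat.log 2 (p '' A).ncard + 1) := by
    intro B hBA hBlo
    by_cases hne : (T \ lo).Nonempty
    · obtain ⟨b, hb, hbmin⟩ := Finset.exists_min_image (T \ lo) (fun e => inner ℝ e x₀) hne
      rw [Finset.mem_sdiff] at hb
      refine compare hH (hS hc) (hS (hT hb.1)) ?_ ?_ ?_
      · refine hfinal _ ((Set.sep_subset _ _).trans hBA)
          ((hTA.mono ((Set.sep_subset _ _).trans hBA)).insert_of_lt_or_gt fun e he => ?_)
        by_cases hel : e ∈ lo
        · exact Or.inl fun x hx => hBlo e hel x hx.1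
        · exact Or.inr fun x hx => hx.2.trans_le
            (hTA.le hx₀ (hBA hx.1) hb.1 he (hbmin e (Finset.mem_sdiff.2 ⟨he, hel⟩)))
      · exact hfinal _ ((Set.sep_subset _ _).trans hBA)
          ((hTA.mono ((Set.sep_subset _ _).trans hBA)).insert_of_eq hb.1 fun x hx => hx.2)
      · refine hhalf _ ((Set.sep_subset _ _).trans hBA) (le_trans ?_ (hhi b hb.1 hb.2))
        exact Nat.mul_le_mul_left 2 (Set.ncard_le_ncard
          (Set.image_mono fun x hx => ⟨hBA hx.1, hx.2⟩) (himfin _))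
    · refine (hfinal B hBA ((hTA.mono hBA).insert_of_lt_or_gt fun e he =>
        Or.inl (hBlo e ?_))).mono (Nat.le_succ _)
      by_contra hel
      exact hne ⟨e, Finset.mem_sdiff.2 ⟨he, hel⟩⟩
  by_cases hne : lo.Nonempty
  · obtain ⟨a, ha, hamax⟩ := Finset.exists_max_image lo (fun e => inner ℝ e x₀) hne
    have haT := ((hmemlo a).1 ha).1
    refine Solvable.mono (compare (k := k + 2 * Nat.log 2 (p '' A).ncard + 1) hH (hS hc)
      (hS (hT haT)) ?_ ?_ ?_) (by omega)
    · exact (hhalf _ (Set.sep_subset _ _) ((hmemlo a).1 ha).2).mono (Nat.le_succ _)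
    · exact (hfinal _ (Set.sep_subset _ _) ((hTA.mono (Set.sep_subset _ _)).insert_of_eq haT
        fun x hx => hx.2)).mono (Nat.le_succ _)
    · refine stage _ (Set.sep_subset _ _) fun e he x hx => lt_of_le_of_lt ?_ hx.2
      exact hTA.le hx₀ hx.1 ((hmemlo e).1 he).1 haT (hamax e he)
  · exact (stage A subset_rfl fun e he => (hne ⟨e, he⟩).elim).mono (by omega)

/-- Sorting the forms of `T ∪ R` when those of `T` are sorted already. -/
theorem Solvable.sorting (hH : H.Nonempty) (hS : S ⊆ insert 0 H) (hfin : (Set.range p).Finite)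
    (hp : ∀ x y, p x = p y → ∀ a ∈ S, ∀ b ∈ S, inner ℝ a x < inner ℝ b x →
      inner ℝ a y < inner ℝ b y) {k : ℕ} (R : Finset (EuclideanSpace ℝ (Fin n)))
    (hR : (R : Set _) ⊆ S) :
    ∀ (T : Finset (EuclideanSpace ℝ (Fin n))) (A : Set (EuclideanSpace ℝ (Fin n))),
      (T : Set _) ⊆ S → A.Nonempty → OrderConst (T : Set _) A →
      (∀ B ⊆ A, B.Nonempty → OrderConst ((T : Set _) ∪ R) B → Solvable H g B k) →
      Solvable H g A (k + 2 * R.card + 2 * Nat.log 2 (p '' A).ncard) := by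
  classical
  induction R using Finset.induction_on with
  | empty =>
    intro T A _ hA hTA h
    exact (h A subset_rfl hA (by simpa using hTA)).mono (by omega)
  | insert c R hc ih =>
    intro T A hT hA hTA h
    rw [Finset.coe_insert, Set.insert_subset_iff] at hR
    rw [Finset.card_insert_of_notMem hc]
    refine (Solvable.insertion (k := k + 2 * R.card) hH hS hfin hp hT hR.1 A hA hTA
      fun B hBA hB hBo => ?_).mono (by omega)
    refine ih hR.2 (insert c T) B ?_ hB (by simpa using hBo) fun C hC hCne hCo => ?_
    · rw [Finset.coe_insert]
      exact Set.insert_subset hR.1 hT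
    · refine h C (hC.trans hBA) hCne ?_
      rw [Finset.coe_insert] at hCo ⊢
      rwa [Set.union_insert, ← Set.insert_union]

end Sorting

/-- All label and comparison queries on `S` can be answered with `O(|S| + n log |S|)` queries. -/
theorem Solvable.of_queryVectors {α : Type*} {H : Set (EuclideanSpace ℝ (Fin n))}
    {g : EuclideanSpace ℝ (Fin n) → α} (hH : H.Nonempty) (S : Finset (EuclideanSpace ℝ (Fin n)))
    (hS : (S : Set _) ⊆ H) {k : ℕ} {A : Set (EuclideanSpace ℝ (Fin n))}
    (h : ∀ B ⊆ A, B.Nonempty → (∀ x ∈ B, ∀ y ∈ B,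
      signVector (queryVectors (S : Set _)) x = signVector (queryVectors (S : Set _)) y) →
      Solvable H g B k) :
    Solvable H g A (k + 2 * (S.card + 1) +
      2 * Nat.log 2 ((2 * (S.card + S.card ^ 2) + 1) ^ n)) := by
  classical
  by_cases hA : A.Nonempty
  · have hbound := encard_queryPattern_le S
    have hfin := Set.finite_of_encard_le_coe hbound
    have hcard : ((signPattern (queryVectors (S : Set _))) '' A).ncard ≤
        (2 * (S.card + S.card ^ 2) + 1) ^ n := by
      refine (Set.ncard_le_ncard (Set.image_subset_range _ A) hfin).trans ?_
      rw [← hfin.cast_ncard_eq] at hbound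
      exact_mod_cast hbound
    refine (Solvable.sorting (k := k) (p := signPattern (queryVectors (S : Set _)))
      (S := insert 0 (S : Set _)) hH
      (Set.insert_subset_insert hS) hfin
      (fun x y hxy a ha b hb => inner_lt_of_signPattern_eq hxy ha hb) (insert 0 S) (by simp)
      ∅ A (by simp) hA (by intro x _ y _ a ha; simp at ha) fun B hB hBne hBo => ?_).mono ?_
    · rw [Finset.coe_empty, Set.empty_union, Finset.coe_insert] at hBo
      exact h B hB hBne fun x hx y hy => hBo.signVector_eq hx hy
    · have h1 := Finset.card_insert_le (0 : EuclideanSpace ℝ (Fin n)) S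
      have h2 := Nat.log_mono_right (b := 2) hcard
      omega
  · exact of_not_nonempty hA

/-! ### Inference and the existence of a good sample -/

/-- Every `S ⊆ H` with at least `d` elements has an element inferred by the others, at every
point. -/
def HasInference (H : Set (EuclideanSpace ℝ (Fin n))) (d : ℕ) : Prop :=
  ∀ S ⊆ H, (d : ℕ∞) ≤ S.encard → ∀ x, ∃ h ∈ S, Infers (S \ {h}) h x

theorem HasInference.mono {H H' : Set (EuclideanSpace ℝ (Fin n))} {d : ℕ}
    (h : HasInference H d) (hH : H' ⊆ H) : HasInference H' d :=
  fun S hS => h S (hS.trans hH)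

theorem queryVectors_mono {S S' : Set (EuclideanSpace ℝ (Fin n))} (h : S ⊆ S') :
    queryVectors S ⊆ queryVectors S' :=
  Set.union_subset_union h (Set.sub_subset_sub h h)

theorem Infers.mono {S S' : Set (EuclideanSpace ℝ (Fin n))} {h x : EuclideanSpace ℝ (Fin n)}
    (hi : Infers S h x) (hS : S ⊆ S') : Infers S' h x := by
  intro x' hx'
  refine hi x' ?_
  rw [signVector_eq_iff] at hx' ⊢
  exact fun q hq => hx' q (queryVectors_mono hS hq)

theorem Infers.of_mem {S : Set (EuclideanSpace ℝ (Fin n))} {h x : EuclideanSpace ℝ (Fin n)}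
    (hh : h ∈ S) : Infers S h x :=
  fun _ hx' => signVector_eq_iff.1 hx' h (Or.inl hh)

theorem Infers.congr {S : Set (EuclideanSpace ℝ (Fin n))} {h x y : EuclideanSpace ℝ (Fin n)}
    (hi : Infers S h x) (hxy : signVector (queryVectors S) x = signVector (queryVectors S) y) :
    Infers S h y :=
  fun x' hx' => (hi x' (hx'.trans hxy.symm)).trans (hi y hxy.symm).symm

/-- The number of small subsets of a set with `2 * (2 * k)` elements. -/
theorem card_filter_card_lt_mul_le {ι : Type*} [DecidableEq ι] (Q : Finset ι) (d k : ℕ)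
    (hQ : Q.card = 4 * k) :
    (Q.powerset.filter fun D => D.card < d).card ≤ 16 ^ d * 2 ^ k := by
  -- Exponential weighting: sets with `|D| < d` have weight `16^(-|D|) ≥ 16^(-d)`, the total weight
  -- is `(17/16)^(4k)`, and `17^4 ≤ 2 * 16^4`.
  have h1 : ∑ D ∈ Q.powerset.filter (fun D => D.card < d), 16 ^ (4 * k) ≤
      ∑ D ∈ Q.powerset, 16 ^ d * (1 ^ D.card * 16 ^ (Q.card - D.card)) := by
    refine (Finset.sum_le_sum fun D hD => ?_).trans
      (Finset.sum_le_sum_of_subset (Finset.filter_subset _ _))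
    rw [one_pow, one_mul, ← pow_add]
    have := (Finset.mem_filter.1 hD).2
    exact Nat.pow_le_pow_right (by norm_num) (by omega)
  rw [← Finset.mul_sum, Finset.sum_pow_mul_eq_add_pow, Finset.sum_const, smul_eq_mul, hQ] at h1
  have h2 : (1 + 16) ^ (4 * k) ≤ 2 ^ k * 16 ^ (4 * k) := by
    rw [pow_mul, pow_mul, ← mul_pow]
    exact Nat.pow_le_pow_left (by norm_num) k
  refine Nat.le_of_mul_le_mul_right (c := 16 ^ (4 * k)) (h1.trans ?_) (by positivity)
  rw [mul_assoc]
  exact Nat.mul_le_mul_left _ h2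

/-- Sauer-Shelah for the subsets of `Q` which infer no further element of `Q` at `y`. -/
theorem card_closed_le {H : Set (EuclideanSpace ℝ (Fin n))} {d k : ℕ} (hH : HasInference H d)
    (Q : Finset (EuclideanSpace ℝ (Fin n))) (hQH : (Q : Set _) ⊆ H) (hQ : Q.card = 4 * k)
    (y : EuclideanSpace ℝ (Fin n)) (𝒜 : Finset (Finset (EuclideanSpace ℝ (Fin n))))
    (h𝒜 : ∀ S ∈ 𝒜, S ⊆ Q ∧ ∀ h ∈ Q, Infers (S : Set _) h y → h ∈ S) :
    𝒜.card ≤ 16 ^ d * 2 ^ k := by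
  classical
  refine (Finset.card_le_card_shatterer 𝒜).trans
    (le_trans (Finset.card_le_card fun D hD => ?_) (card_filter_card_lt_mul_le Q d k hQ))
  rw [Finset.mem_shatterer] at hD
  have hDQ : D ⊆ Q := by
    obtain ⟨u, hu, hDu⟩ := hD (Finset.Subset.refl D)
    exact (Finset.inter_eq_left.1 hDu).trans (h𝒜 u hu).1
  refine Finset.mem_filter.2 ⟨Finset.mem_powerset.2 hDQ, ?_⟩
  by_contra hcard
  obtain ⟨h, hhD, hinf⟩ := hH (D : Set _) ((Finset.coe_subset.2 hDQ).trans hQH)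
    (by rw [Set.encard_coe_eq_coe_finsetCard]; exact_mod_cast not_lt.1 hcard) y
  -- A shattered `D` with at least `d` elements contains some `h` inferred by `D \ {h}`. A member
  -- `u` with trace `D \ {h}` then infers `h` without containing it, so it is not closed.
  obtain ⟨u, hu, hDu⟩ := hD (Finset.erase_subset h D)
  have hsub : (D : Set _) \ {h} ⊆ (u : Set (EuclideanSpace ℝ (Fin n))) := by
    rw [← Finset.coe_erase, ← hDu]
    exact Finset.coe_subset.2 Finset.inter_subset_right
  have hmem := (h𝒜 u hu).2 h (hDQ hhD) (hinf.mono hsub)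
  have : h ∈ D.erase h := hDu ▸ Finset.mem_inter.2 ⟨hhD, hmem⟩
  simp at this

/-- One point per answer pattern on `Q`: this reduces "at some point" to finitely many points in the
double count. -/
theorem exists_representatives (Q : Finset (EuclideanSpace ℝ (Fin n))) :
    ∃ X : Finset (EuclideanSpace ℝ (Fin n)), X.card ≤ (2 * (Q.card + Q.card ^ 2) + 1) ^ n ∧
      ∀ x, ∃ y ∈ X, ∀ q ∈ queryVectors (Q : Set (EuclideanSpace ℝ (Fin n))),
        (SignType.sign (inner ℝ q x) : SignType) = SignType.sign (inner ℝ q y) := by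
  classical
  have hbound := encard_queryPattern_le Q
  have hfin := Set.finite_of_encard_le_coe hbound
  choose r hr using fun σ : Set.range (signPattern (queryVectors (Q : Set (EuclideanSpace ℝ (Fin n))))) => σ.2
  have := hfin.fintype
  refine ⟨Finset.univ.image r, Finset.card_image_le.trans ?_, fun x => ?_⟩
  · rw [Set.encard_eq_coe_toFinset_card, Set.toFinset_card] at hbound
    exact_mod_cast hbound
  · exact ⟨r ⟨_, x, rfl⟩, Finset.mem_image_of_mem r (Finset.mem_univ _),
      signPattern_eq_iff.1 (hr ⟨_, x, rfl⟩).symm⟩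

theorem descFactorial_le_two_pow_mul {a b : ℕ} (m : ℕ) (h : ∀ i < m, a - i ≤ 2 * (b - i)) :
    a.descFactorial m ≤ 2 ^ m * b.descFactorial m := by
  induction m with
  | zero => simp
  | succ m ih =>
    rw [Nat.descFactorial_succ, Nat.descFactorial_succ, pow_succ]
    calc (a - m) * a.descFactorial m
        ≤ (2 * (b - m)) * (2 ^ m * b.descFactorial m) :=
          Nat.mul_le_mul (h m (Nat.lt_succ_self m)) (ih fun i hi => h i (by omega))
      _ = _ := by ring

theorem choose_le_two_pow_mul {N u m : ℕ} (hN : 4 * m ≤ N) (hu : 3 * N ≤ 4 * u) :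
    (N - m).choose m ≤ 2 ^ m * u.choose m := by
  have h := descFactorial_le_two_pow_mul (a := N - m) (b := u) m fun i hi => by omega
  rw [Nat.descFactorial_eq_factorial_mul_choose, Nat.descFactorial_eq_factorial_mul_choose] at h
  refine Nat.le_of_mul_le_mul_left (c := m.factorial) (h.trans (le_of_eq (by ring)))
    (Nat.factorial_pos m)

/-- A set `S` of `2 * k` vectors from `H` which at every point infers a quarter of `H`. -/
theorem exists_inferring_subset (H : Finset (EuclideanSpace ℝ (Fin n))) {d k : ℕ}
    (hH : HasInference (H : Set (EuclideanSpace ℝ (Fin n))) d) (hcard : 4 * (2 * k) ≤ H.card) (hk : 0 < k)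
    (hparam : 2 * (2 * k) * ((2 * (4 * k + (4 * k) ^ 2) + 1) ^ n * 16 ^ d) < 2 ^ k) :
    ∃ S ⊆ H, S.card = 2 * k ∧ ∀ x, ∀ U ⊆ H, (∀ h ∈ U, ¬ Infers (S : Set (EuclideanSpace ℝ (Fin n))) h x) →
      4 * U.card ≤ 3 * H.card := by
  classical
  by_contra! hcon
  set N := H.card with hN
  -- Double count of pairs `(S, Q)` in which, at some point, `S` infers no element of `Q \ S`. The
  -- number `(3N + 3) / 4` is `3N/4` rounded up.
  have hcount := Finset.card_mul_le_card_mul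
    (s := H.powersetCard (2 * k)) (t := H.powersetCard (4 * k))
    (m := ((3 * N + 3) / 4).choose (2 * k))
    (n := (2 * (4 * k + (4 * k) ^ 2) + 1) ^ n * (16 ^ d * 2 ^ k))
    (fun S Q : Finset (EuclideanSpace ℝ (Fin n)) => S ⊆ Q ∧
      ∃ x, ∀ h ∈ Q, Infers (S : Set (EuclideanSpace ℝ (Fin n))) h x → h ∈ S) ?_ ?_
  · rw [Finset.card_powersetCard, Finset.card_powersetCard, ← hN] at hcount
    have h1 := choose_le_two_pow_mul (N := N) (u := (3 * N + 3) / 4) (m := 2 * k) hcard (by omega)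
    have h2 := Nat.choose_mul (n := N) (k := 4 * k) (s := 2 * k) (by omega)
    rw [show 4 * k - 2 * k = 2 * k by omega] at h2
    -- The central binomial is at least `2^(4k) / (4k)`, whereas the count bounds it by `2^(3k) * P
    -- * 16^d`; hence `2^k ≤ 4k * P * 16^d`, against `hparam`.
    have h3 := Nat.four_pow_le_two_mul_self_mul_centralBinom (2 * k) (by omega)
    rw [Nat.centralBinom_eq_two_mul_choose, show 2 * (2 * k) = 4 * k by ring] at h3
    have hpos : 0 < N.choose (4 * k) := Nat.choose_pos (by omega)
    set P := (2 * (4 * k + (4 * k) ^ 2) + 1) ^ n with hP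
    have h4 : (4 * k).choose (2 * k) ≤ 2 ^ (2 * k) * (P * (16 ^ d * 2 ^ k)) := by
      refine Nat.le_of_mul_le_mul_left (c := N.choose (4 * k)) ?_ hpos
      calc N.choose (4 * k) * (4 * k).choose (2 * k)
          = N.choose (2 * k) * (N - 2 * k).choose (2 * k) := h2
        _ ≤ N.choose (2 * k) * (2 ^ (2 * k) * ((3 * N + 3) / 4).choose (2 * k)) :=
            Nat.mul_le_mul_left _ h1
        _ = 2 ^ (2 * k) * (N.choose (2 * k) * ((3 * N + 3) / 4).choose (2 * k)) := by ring
        _ ≤ 2 ^ (2 * k) * (N.choose (4 * k) * (P * (16 ^ d * 2 ^ k))) :=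
            Nat.mul_le_mul_left _ hcount
        _ = _ := by ring
    have h5 : 4 ^ (2 * k) = 2 ^ (2 * k) * (2 ^ k * 2 ^ k) := by
      rw [show (4 : ℕ) = 2 ^ 2 by norm_num, ← pow_mul, ← pow_add, ← pow_add]
      congr 1
      ring
    have h6 : 2 ^ (2 * k) * (2 ^ k * 2 ^ k) ≤
        2 ^ (2 * k) * ((4 * k * (P * 16 ^ d)) * 2 ^ k) := by
      rw [← h5]
      refine h3.trans ((Nat.mul_le_mul_left _ h4).trans (le_of_eq ?_))
      ring
    have h7 := Nat.le_of_mul_le_mul_right (Nat.le_of_mul_le_mul_left h6 (by positivity))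
      (by positivity)
    rw [show 2 * (2 * k) = 4 * k by ring] at hparam
    omega
  · intro S hS
    obtain ⟨hSH, hSc⟩ := Finset.mem_powersetCard.1 hS
    -- Each `2k`-subset `W` of the uninferred set `U` gives a distinct partner `S ∪ W` of `S`.
    obtain ⟨x, U, hUH, hU, hUc⟩ := hcon S hSH hSc
    have hdisj : Disjoint S U := Finset.disjoint_left.2 fun h hhS hhU =>
      hU h hhU (Infers.of_mem (Finset.mem_coe.2 hhS))
    calc ((3 * N + 3) / 4).choose (2 * k) ≤ U.card.choose (2 * k) :=
          Nat.choose_le_choose _ (by omega)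
      _ = (U.powersetCard (2 * k)).card := (Finset.card_powersetCard _ _).symm
      _ ≤ _ := Finset.card_le_card_of_injOn (fun W => S ∪ W) ?_ ?_
    · intro W hW
      obtain ⟨hWU, hWc⟩ := Finset.mem_powersetCard.1 hW
      refine Finset.mem_coe.2 ((Finset.mem_bipartiteAbove _).2
        ⟨Finset.mem_powersetCard.2 ⟨Finset.union_subset hSH (hWU.trans hUH), ?_⟩,
          Finset.subset_union_left, x, fun h hh hi => ?_⟩)
      · rw [Finset.card_union_of_disjoint (hdisj.mono_right hWU), hSc, hWc]
        ring
      · exact (Finset.mem_union.1 hh).resolve_right fun hhW => hU h (hWU hhW) hi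
    · intro W hW W' hW' hWW
      have hW := (Finset.mem_powersetCard.1 hW).1
      have hW' := (Finset.mem_powersetCard.1 hW').1
      have e := congrArg (· \ S) hWW
      simp only [Finset.union_sdiff_left] at e
      rwa [Finset.sdiff_eq_self_of_disjoint (hdisj.mono_right hW).symm,
        Finset.sdiff_eq_self_of_disjoint (hdisj.mono_right hW').symm] at e
  · intro Q hQ
    obtain ⟨hQH, hQc⟩ := Finset.mem_powersetCard.1 hQ
    obtain ⟨X, hXc, hX⟩ := exists_representatives Q
    rw [hQc] at hXc
    -- For each representative `y`, the partners `S` of `Q` that are closed at `y` are counted by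
    -- `card_closed_le`.
    refine le_trans (Finset.card_le_card (t := X.biUnion fun y => Q.powerset.filter
      fun S : Finset (EuclideanSpace ℝ (Fin n)) => ∀ h ∈ Q, Infers (S : Set (EuclideanSpace ℝ (Fin n))) h y → h ∈ S) ?_) ?_
    · intro S hS
      obtain ⟨-, hSQ, x, hx⟩ := (Finset.mem_bipartiteBelow _).1 hS
      obtain ⟨y, hy, hxy⟩ := hX x
      refine Finset.mem_biUnion.2 ⟨y, hy, Finset.mem_filter.2 ⟨Finset.mem_powerset.2 hSQ, ?_⟩⟩
      refine fun h hh hi => hx h hh (hi.congr (signVector_eq_iff.2 fun q hq => ?_))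
      exact (hxy q (queryVectors_mono (Finset.coe_subset.2 hSQ) hq)).symm
    · refine (Finset.card_biUnion_le_card_mul X _ (16 ^ d * 2 ^ k) fun y _ => ?_).trans
        (Nat.mul_le_mul_right _ hXc)
      refine card_closed_le hH Q (Finset.coe_subset.2 hQH) hQc y _ fun S hS => ?_
      obtain ⟨h1, h2⟩ := Finset.mem_filter.1 hS
      exact ⟨Finset.mem_powerset.1 h1, h2⟩

/-! ### The rounds and their total cost -/

/-- Each round infers a quarter of the remaining vectors `R`. -/
theorem Solvable.of_remaining {F : Finset (EuclideanSpace ℝ (Fin n))} {d k : ℕ}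
    (hF : F.Nonempty) (hd : HasInference (F : Set (EuclideanSpace ℝ (Fin n))) d) (hk : 0 < k)
    (hparam : 2 * (2 * k) * ((2 * (4 * k + (4 * k) ^ 2) + 1) ^ n * 16 ^ d) < 2 ^ k) (r : ℕ) :
    ∀ R ⊆ F, 3 ^ r * R.card ≤ 4 ^ r * (8 * k) → ∀ A : Set (EuclideanSpace ℝ (Fin n)),
      (∀ h ∈ F, h ∉ R → ∀ x ∈ A, ∀ y ∈ A,
        (SignType.sign (inner ℝ h x) : SignType) = SignType.sign (inner ℝ h y)) →
      Solvable (F : Set (EuclideanSpace ℝ (Fin n)))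
        (signVector (F : Set (EuclideanSpace ℝ (Fin n)))) A ((r + 1) * (8 * k)) := by
  classical
  have hsmall : ∀ R ⊆ F, R.card ≤ 8 * k → ∀ A : Set (EuclideanSpace ℝ (Fin n)),
      (∀ h ∈ F, h ∉ R → ∀ x ∈ A, ∀ y ∈ A,
        (SignType.sign (inner ℝ h x) : SignType) = SignType.sign (inner ℝ h y)) →
      Solvable (F : Set (EuclideanSpace ℝ (Fin n)))
        (signVector (F : Set (EuclideanSpace ℝ (Fin n)))) A (8 * k) := by
    intro R hR hRk A hA
    refine (Solvable.of_labels (k := 0) R (Finset.coe_subset.2 hR) A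
      fun B hBA hB => of_const fun x hx y hy => ?_).mono (by omega)
    rw [signVector_eq_iff]
    intro h hh
    by_cases hhR : h ∈ R
    · exact hB h hhR x hx y hy
    · exact hA h hh hhR x (hBA hx) y (hBA hy)
  induction r with
  | zero =>
    intro R hR hRk A hA
    exact (hsmall R hR (by simpa using hRk) A hA).mono (by omega)
  | succ r ih =>
    intro R hR hRk A hA
    by_cases hRs : R.card ≤ 8 * k
    · exact (hsmall R hR hRs A hA).mono (Nat.le_mul_of_pos_left _ (by omega))
    · obtain ⟨S, hSR, hSc, hS⟩ := exists_inferring_subset R (hd.mono (Finset.coe_subset.2 hR))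
        (by omega) hk hparam
      -- `hparam` also bounds the sorting overhead: a round costs at most `2(2k + 1) + 2k ≤ 8k`
      -- queries.
      have hlog : Nat.log 2 ((2 * (S.card + S.card ^ 2) + 1) ^ n) ≤ k := by
        rw [hSc]
        refine (Nat.log_mono_right (b := 2) (m := 2 ^ k) ?_).trans (Nat.log_pow one_lt_two k).le
        have h1 : (2 * (2 * k + (2 * k) ^ 2) + 1) ^ n ≤ (2 * (4 * k + (4 * k) ^ 2) + 1) ^ n :=
          Nat.pow_le_pow_left (by nlinarith) n
        have h2 : (2 * (4 * k + (4 * k) ^ 2) + 1) ^ n ≤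
            (2 * (4 * k + (4 * k) ^ 2) + 1) ^ n * 16 ^ d := Nat.le_mul_of_pos_right _ (by positivity)
        have h3 : (2 * (4 * k + (4 * k) ^ 2) + 1) ^ n * 16 ^ d ≤
            2 * (2 * k) * ((2 * (4 * k + (4 * k) ^ 2) + 1) ^ n * 16 ^ d) :=
          Nat.le_mul_of_pos_left _ (by omega)
        omega
      refine (Solvable.of_queryVectors (k := (r + 1) * (8 * k)) (Finset.coe_nonempty.2 hF) S
        (Finset.coe_subset.2 (hSR.trans hR)) fun B hBA hBne hB => ?_).mono ?_
      · obtain ⟨x₀, hx₀⟩ := hBne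
        refine ih (R.filter fun h => ¬ Infers (S : Set _) h x₀)
          ((Finset.filter_subset _ _).trans hR) ?_ B ?_
        · have := hS x₀ (R.filter fun h => ¬ Infers (S : Set _) h x₀) (Finset.filter_subset _ _)
            fun h hh => (Finset.mem_filter.1 hh).2
          refine Nat.le_of_mul_le_mul_left (c := 4) ?_ (by norm_num)
          calc 4 * (3 ^ r * (R.filter fun h => ¬ Infers (S : Set _) h x₀).card)
              = 3 ^ r * (4 * (R.filter fun h => ¬ Infers (S : Set _) h x₀).card) := by ring
            _ ≤ 3 ^ r * (3 * R.card) := Nat.mul_le_mul_left _ this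
            _ = 3 ^ (r + 1) * R.card := by ring
            _ ≤ 4 ^ (r + 1) * (8 * k) := hRk
            _ = 4 * (4 ^ r * (8 * k)) := by ring
        · intro h hh hhR x hx y hy
          by_cases hR' : h ∈ R
          · have hinf : Infers (S : Set _) h x₀ := by
              by_contra hni
              exact hhR (Finset.mem_filter.2 ⟨hR', hni⟩)
            rw [hinf x (hB x hx x₀ hx₀), hinf y (hB y hy x₀ hx₀)]
          · exact hA h hh hR' x (hBA hx) y (hBA hy)
      · rw [hSc] at hlog ⊢
        rw [add_mul (r + 1) 1]
        omega

theorem Solvable.of_hasInference {F : Finset (EuclideanSpace ℝ (Fin n))} {d k : ℕ}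
    (hF : 2 ≤ F.card) (hd : HasInference (F : Set (EuclideanSpace ℝ (Fin n))) d) (hk : 0 < k)
    (hparam : 2 * (2 * k) * ((2 * (4 * k + (4 * k) ^ 2) + 1) ^ n * 16 ^ d) < 2 ^ k) :
    Solvable (F : Set (EuclideanSpace ℝ (Fin n)))
      (signVector (F : Set (EuclideanSpace ℝ (Fin n)))) Set.univ (56 * k * Nat.log 2 F.card) := by
  have hlog : 1 ≤ Nat.log 2 F.card := Nat.log_pos one_lt_two hF
  -- Three rounds at least halve the remaining set, as `(3/4)^3 = 27/64 < 1/2`. With `L = Nat.log 2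
  -- F.card ≥ 1`, the total is `(3(L + 1) + 1) * 8k ≤ 56kL`.
  refine (Solvable.of_remaining (Finset.card_pos.1 (by omega)) hd hk hparam
    (3 * (Nat.log 2 F.card + 1)) F subset_rfl ?_ Set.univ fun h hh hh' => (hh' hh).elim).mono ?_
  · have h1 : F.card < 2 ^ (Nat.log 2 F.card + 1) := Nat.lt_pow_succ_log_self one_lt_two _
    calc 3 ^ (3 * (Nat.log 2 F.card + 1)) * F.card
        ≤ 27 ^ (Nat.log 2 F.card + 1) * 2 ^ (Nat.log 2 F.card + 1) := by
          rw [pow_mul]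
          exact Nat.mul_le_mul (by norm_num) h1.le
      _ = 54 ^ (Nat.log 2 F.card + 1) := by rw [← mul_pow]; norm_num
      _ ≤ 64 ^ (Nat.log 2 F.card + 1) := Nat.pow_le_pow_left (by norm_num) _
      _ = 4 ^ (3 * (Nat.log 2 F.card + 1)) := by rw [pow_mul]; norm_num
      _ ≤ _ := Nat.le_mul_of_pos_right _ (by omega)
  · nlinarith

/-! ### Choice of parameters and the final bound -/

/-- A sample size that is large enough for `exists_inferring_subset`. -/
theorem sample_size_sufficient {n d : ℕ} (hn : 1 ≤ n) (hd : 1 ≤ d) (hnd : 2 ≤ n * d) {k l : ℕ}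
    (hl : l = Nat.log 2 (n * d) + 1) (hk : k = 32 * (d + n * l)) :
    2 * (2 * k) * ((2 * (4 * k + (4 * k) ^ 2) + 1) ^ n * 16 ^ d) < 2 ^ k := by
  have hl2 : 2 ≤ l := by
    have := Nat.log_pos one_lt_two hnd
    omega
  have hndl : n * d ≤ 2 ^ l := by
    rw [hl]
    exact (Nat.lt_pow_succ_log_self one_lt_two _).le
  have hn' : n ≤ 2 ^ l := (Nat.le_mul_of_pos_right n hd).trans hndl
  have hd' : d ≤ 2 ^ l := (Nat.le_mul_of_pos_left d hn).trans hndl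
  have hll : l ≤ 2 ^ l := Nat.lt_two_pow_self.le
  -- A crude bound polynomial in `nd` suffices, since `k` enters `hparam` on the left only through
  -- its logarithm, multiplied by O(n).
  have hk' : k ≤ 2 ^ (6 + 2 * l) := by
    have h1 : n * l ≤ 2 ^ l * 2 ^ l := Nat.mul_le_mul hn' hll
    have h2 : 2 ^ l ≤ 2 ^ l * 2 ^ l := Nat.le_mul_of_pos_left _ (by positivity)
    have h3 : 2 ^ (6 + 2 * l) = 64 * (2 ^ l * 2 ^ l) := by
      rw [pow_add, two_mul, pow_add]
      norm_num
    omega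
  have hpos : 1 ≤ k := by rw [hk]; omega
  have hP : 2 * (4 * k + (4 * k) ^ 2) + 1 ≤ 2 ^ (18 + 4 * l) := by
    calc 2 * (4 * k + (4 * k) ^ 2) + 1 ≤ 64 * k ^ 2 := by nlinarith
      _ ≤ 64 * (2 ^ (6 + 2 * l)) ^ 2 := Nat.mul_le_mul_left _ (Nat.pow_le_pow_left hk' 2)
      _ = 2 ^ (18 + 4 * l) := by
        rw [← pow_mul, show (64 : ℕ) = 2 ^ 6 by norm_num, ← pow_add]
        congr 1
        ring
  calc 2 * (2 * k) * ((2 * (4 * k + (4 * k) ^ 2) + 1) ^ n * 16 ^ d)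
      ≤ 2 * (2 * 2 ^ (6 + 2 * l)) * ((2 ^ (18 + 4 * l)) ^ n * (2 ^ 4) ^ d) := by
        gcongr
        norm_num
    _ = 2 ^ (8 + 2 * l + (18 + 4 * l) * n + 4 * d) := by
        rw [← pow_mul, ← pow_mul]
        ring
    _ < 2 ^ k := by
        refine Nat.pow_lt_pow_right one_lt_two ?_
        have h1 : l ≤ n * l := Nat.le_mul_of_pos_left l hn
        have h2 : n * 2 ≤ n * l := Nat.mul_le_mul_left n hl2
        have h3 : (18 + 4 * l) * n = 18 * n + 4 * (n * l) := by ring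
        omega

/-- If `d = 1`, the empty set infers each `h ∈ H` at 0, so the sign of `⟨h, ·⟩` vanishes identically
and `h = 0`. The bound gives `n * d ≥ 2`, hence a positive `log (n * d)`. -/
theorem two_le_of_hasInference {H : Set (EuclideanSpace ℝ (Fin n))} {d : ℕ}
    (hH : HasInference H d) (hd : 1 ≤ d) (hcard : 2 ≤ H.ncard) : 2 ≤ d := by
  by_contra hlt
  obtain rfl : d = 1 := by omega
  have hzero : H ⊆ {0} := by
    intro h hh
    obtain ⟨h', rfl, hinf⟩ := hH {h} (by simpa using hh) (by simp) 0
    have := hinf h' (by rw [signVector_eq_iff]; simp [queryVectors])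
    simpa [sign_eq_zero_iff] using this
  have := Set.ncard_le_ncard hzero
  rw [Set.ncard_singleton] at this
  omega

theorem natLog_two_le_two_mul_log {N : ℕ} (hN : N ≠ 0) :
    (Nat.log 2 N : ℝ) ≤ 2 * Real.log N := by
  have h1 : (2 : ℝ) ^ Nat.log 2 N ≤ N := by exact_mod_cast Nat.pow_log_le_self 2 hN
  have h2 := Real.log_le_log (by positivity) h1
  rw [Real.log_pow] at h2
  have h3 := Real.log_two_gt_d9
  have h4 : (0 : ℝ) ≤ Nat.log 2 N := Nat.cast_nonneg _
  nlinarith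

end PointLocation

theorem mainTheorem2 :
    ∃ C : ℝ, 0 < C ∧
      ∀ (n : ℕ) (H : Set (EuclideanSpace ℝ (Fin n))) (d : ℕ),
        H.Finite → 2 ≤ H.ncard → PointLocation.IsInferenceDimension H d →
        ∃ T : PointLocation.LinearDecisionTree n (↥H → SignType),
          T.IsComparisonTree H ∧
          (∀ x : EuclideanSpace ℝ (Fin n), T.eval x = PointLocation.signVector H x) ∧
          ∀ x : EuclideanSpace ℝ (Fin n), (T.numQueries x : ℝ) ≤
            C * (((d : ℝ) + (n : ℝ) * Real.log ((n : ℝ) * (d : ℝ))) *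
              Real.log (H.ncard : ℝ)) := by
  -- The factor 56 comes from the rounds and 32 from the sample size; 4 absorbs the passage from
  -- `Nat.log 2 (n * d) + 1` to the natural logarithm, and 2 the one for `|H|`.
  refine ⟨56 * 32 * 4 * 2, by norm_num, fun n H d hfin hcard hdim => ?_⟩
  obtain ⟨hd1, hinf⟩ := hdim.1
  have hd2 : 2 ≤ d := PointLocation.two_le_of_hasInference hinf hd1 hcard
  have hn : 1 ≤ n := by
    by_contra hn
    obtain rfl : n = 0 := by omega
    have := Set.ncard_le_one_of_subsingleton H
    omega
  lift H to Finset (EuclideanSpace ℝ (Fin n)) using hfin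
  rw [Set.ncard_coe_finset] at hcard ⊢
  have hnd : 2 ≤ n * d := hd2.trans (Nat.le_mul_of_pos_left d hn)
  obtain ⟨T, hT, h⟩ := PointLocation.Solvable.of_hasInference hcard hinf (by omega)
    (PointLocation.sample_size_sufficient hn hd1 hnd rfl rfl)
  refine ⟨T, hT, fun x => (h x trivial).1, fun x => ?_⟩
  have hq : (T.numQueries x : ℝ) ≤
      56 * (32 * (d + n * (Nat.log 2 (n * d) + 1))) * Nat.log 2 H.card := by
    exact_mod_cast (h x trivial).2
  have hl : (Nat.log 2 (n * d) : ℝ) + 1 ≤ 4 * Real.log (n * d) := by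
    have h1 := PointLocation.natLog_two_le_two_mul_log (N := n * d) (by omega)
    have h2 : (1 : ℝ) ≤ Nat.log 2 (n * d) := by exact_mod_cast Nat.log_pos one_lt_two hnd
    push_cast at h1
    linarith
  have hH := PointLocation.natLog_two_le_two_mul_log (N := H.card) (by omega)
  have hlog : 0 ≤ Real.log (n * d) := Real.log_nonneg (by exact_mod_cast (by omega : 1 ≤ n * d))
  refine hq.trans ?_
  calc (56 * (32 * (d + n * (Nat.log 2 (n * d) + 1))) * Nat.log 2 H.card : ℝ)
      ≤ 56 * (32 * (4 * d + n * (4 * Real.log (n * d)))) * (2 * Real.log H.card) := by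
        gcongr
        linarith [(Nat.cast_nonneg d : (0 : ℝ) ≤ d)]
    _ = _ := by ring
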